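/- Let $R$ be any ring with identity, let $\mathrm{Ch}(R)$ be the category of (unbounded) chain complexes of left $R$-modules, with differentials lowering degree, and let $\mathrm{Ch}(\mathrm{Ch}(R))$ be the category of chain complexes over $\mathrm{Ch}(R)$. Let $D^n(R)$ be the complex $R \xrightarrow{1} R$ concentrated in degrees $n$ and $n-1$. A complex in $\mathrm{Ch}(R)$ is free if it is isomorphic to a direct sum $\bigoplus_{i\in I} D^{n_i}(R)$, and it is finitely generated if, whenever it is the sum of a family of subcomplexes, it is the sum of finitely many of them. Let $\mathcal S$ be the class of all $\mathbb X \in \mathrm{Ch}(\mathrm{Ch}(R))$ such that every $\mathbb X_n$ is a finitely generated free complex and $\mathbb X_n = 0$ for all sufficiently large $n$. For a class $\mathcal C$ of objects of an abelian category let $\mathcal C^{\perp}$ (respectively ${}^{\perp}\mathcal C$) be the class of all objects $Y$ with $\mathrm{Ext}^1(C,Y)=0$ (respectively $\mathrm{Ext}^1(Y,C)=0$) for all $C \in \mathcal C$. A pair $(\mathcal X,\mathcal Y)$ is a cotorsion pair if $\mathcal Y = \mathcal X^{\perp}$ and $\mathcal X = {}^{\perp}\mathcal Y$; it is functorially complete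 if for every object $A$ there are short exact sequences $0\to A\to Y\to X\to 0$ and $0\to Y'\to X'\to A\to 0$, both functorial in $A$, with $X,X'\in\mathcal X$ and $Y,Y'\in\mathcal Y$. Theorem. Up to isomorphism $\mathcal S$ is a set; the pair $({}^{\perp}(\mathcal S^{\perp}),\mathcal S^{\perp})$ is a functorially complete cotorsion pair in $\mathrm{Ch}(\mathrm{Ch}(R))$; and ${}^{\perp}(\mathcal S^{\perp})$ is exactly the class of all $\mathbb P \in \mathrm{Ch}(\mathrm{Ch}(R))$ such that every $\mathbb P_n$ is a projective object of $\mathrm{Ch}(R)$. -/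

import Mathlib

open CategoryTheory CategoryTheory.Limits

universe v u

noncomputable section

namespace CotorsionPairs

section Abelian

variable {C : Type u} [Category.{v} C] [Abelian C]

/-- `Ext¹(X, Y) = 0`, where `Ext` is Mathlib's Ext-group of the abelian category `C`. -/
def ExtOneVanishes (X Y : C) : Prop :=
  letI : HasExt.{max u v} C := HasExt.standard C
  Subsingleton (Abelian.Ext.{max u v} X Y 1)

/-- The right orthogonal of a class `P`: all `Y` with `Ext¹(X, Y) = 0` for all `X` in `P`. -/
def rightPerp (P : ObjectProperty C) : ObjectProperty C :=
  fun Y => ∀ X : C, P X → ExtOneVanishes X Y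

/-- The left orthogonal of a class `P`: all `X` with `Ext¹(X, Y) = 0` for all `Y` in `P`. -/
def leftPerp (P : ObjectProperty C) : ObjectProperty C :=
  fun X => ∀ Y : C, P Y → ExtOneVanishes X Y

/-- `(P, Q)` is a cotorsion pair. -/
structure IsCotorsionPair (P Q : ObjectProperty C) : Prop where
  right_eq : Q = rightPerp P
  left_eq : P = leftPerp Q

/-- Enough injectives, functorially: there are short exact sequences `0 ⟶ A ⟶ Y ⟶ X ⟶ 0`,
functorial in `A`, with `Y` in `Q` and `X` in `P`. -/
def HasEnoughFunctorialInjectives (P Q : ObjectProperty C) : Prop :=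
  ∃ F : C ⥤ ShortComplex C, Nonempty (F ⋙ ShortComplex.π₁ ≅ 𝟭 C) ∧
    ∀ A : C, (F.obj A).ShortExact ∧ Q (F.obj A).X₂ ∧ P (F.obj A).X₃

/-- Enough projectives, functorially: there are short exact sequences `0 ⟶ Y ⟶ X ⟶ A ⟶ 0`,
functorial in `A`, with `Y` in `Q` and `X` in `P`. -/
def HasEnoughFunctorialProjectives (P Q : ObjectProperty C) : Prop :=
  ∃ F : C ⥤ ShortComplex C, Nonempty (F ⋙ ShortComplex.π₃ ≅ 𝟭 C) ∧
    ∀ A : C, (F.obj A).ShortExact ∧ Q (F.obj A).X₁ ∧ P (F.obj A).X₂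

/-- `(P, Q)` is a functorially complete cotorsion pair. -/
structure IsFunctoriallyCompleteCotorsionPair (P Q : ObjectProperty C) : Prop where
  isCotorsionPair : IsCotorsionPair P Q
  enoughInjectives : HasEnoughFunctorialInjectives P Q
  enoughProjectives : HasEnoughFunctorialProjectives P Q

end Abelian

section Complexes

variable (R : Type u) [Ring R]

/-- `Ch(R)`: unbounded chain complexes of left `R`-modules, with differentials lowering degree. -/
abbrev Ch := ChainComplex (ModuleCat.{u} R) ℤ

/-- `Ch(Ch(R))`: unbounded chain complexes of chain complexes of left `R`-modules. -/
abbrev ChCh := ChainComplex (Ch R) ℤ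

/-- The disk `Dⁿ(R)`: the complex `R ⟶ R` (the identity) in degrees `n` and `n - 1`. -/
def disk (n : ℤ) : Ch R :=
  HomologicalComplex.double (c := ComplexShape.down ℤ) (i₀ := n) (i₁ := n - 1)
    (𝟙 (ModuleCat.of R R)) (sub_add_cancel n 1)

variable {R}

/-- A chain complex is free if it is isomorphic to a direct sum of disks `D^{nᵢ}(R)`. -/
def IsFreeComplex (F : Ch R) : Prop :=
  ∃ (I : Type u) (n : I → ℤ), Nonempty (F ≅ ∐ fun i => disk R (n i))

/-- A chain complex `X` is finitely generated if whenever `X` is the sum of a family of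
subcomplexes `S i`, it is the sum of finitely many of them. -/
def IsFinitelyGeneratedComplex (X : Ch R) : Prop :=
  ∀ (I : Type u) (S : I → ∀ n : ℤ, Submodule R (X.X n)),
    (∀ (i : I) (m n : ℤ), (S i m).map (X.d m n).hom ≤ S i n) →
    (∀ n : ℤ, ⨆ i, S i n = ⊤) →
    ∃ J : Finset I, ∀ n : ℤ, ⨆ i ∈ J, S i n = ⊤

variable (R)

/-- The class of all bounded above complexes of finitely generated free complexes. -/
def boundedAboveFGFree : ObjectProperty (ChCh R) :=
  fun X => (∃ N : ℤ, ∀ n : ℤ, N < n → IsZero (X.X n)) ∧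
    ∀ n : ℤ, IsFreeComplex (X.X n) ∧ IsFinitelyGeneratedComplex (X.X n)

/-- The class of all complexes of projective complexes. -/
def complexesOfProjectives : ObjectProperty (ChCh R) :=
  fun X => ∀ n : ℤ, Projective (X.X n)

end Complexes

end CotorsionPairs

end

open scoped ZeroObject

universe w

noncomputable section

namespace CotorsionPairs

section Abelian

variable {C : Type u} [Category.{v} C] [Abelian C]

/-! ### Vanishing of `Ext¹` in terms of lifting and extension of morphisms -/

/-! A finitely generated free complex is a coproduct of finitely many disks, so the class is a set
up to isomorphism. The small object argument, applied to the kernels of projective presentations of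
its members and to `0 ⟶ Q` for a projective separator `Q`, then gives both functorial approximation
sequences (`isFunctoriallyCompleteCotorsionPair_of_essentiallySmall`).

For the left orthogonal, one inclusion tests against contractible complexes: they are right
orthogonal to every complex of projectives, and a complex whose `Ext¹` into all of them vanishes has
projective components.

Conversely, an Eilenberg swindle makes a complex of projectives a retract of a complex `X` of free
complexes (`exists_retract_isFreeComplex`). Extensions of `X` by `Y` split degreewise, so they are
twisted differentials on `Y ⊞ X`, and `Ext¹` vanishes once all such cocycles are coboundaries. A
disk is generated by one element, so the differential sends each disk summand into finitely many
others; hence each summand lies in a bounded above subcomplex with finitely many disks in each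
degree. By Zorn's lemma a cocycle is trivialized one such piece at a time, the obstruction at each
stage living on a subquotient which again belongs to the class (`isCoboundary_of_subquotient`). -/

lemma ExtOneVanishes.exists_lift {S : ShortComplex C} (hS : S.ShortExact) {X : C}
    (h : ExtOneVanishes X S.X₁) (g : X ⟶ S.X₃) : ∃ l : X ⟶ S.X₂, l ≫ S.g = g := by
  let : HasExt.{max u v} C := HasExt.standard C
  have h' : Subsingleton (Abelian.Ext.{max u v} X S.X₁ 1) := h
  obtain ⟨x, hx⟩ := Abelian.Ext.covariant_sequence_exact₃ X hS (Abelian.Ext.mk₀ g)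
    (zero_add 1) (Subsingleton.elim _ _)
  obtain ⟨l, rfl⟩ := (Abelian.Ext.mk₀_bijective _ _).2 x
  refine ⟨l, (Abelian.Ext.mk₀_bijective _ _).1 ?_⟩
  rw [← hx, Abelian.Ext.mk₀_comp_mk₀]

lemma ExtOneVanishes.exists_extension {S : ShortComplex C} (hS : S.ShortExact) {Y : C}
    (h : ExtOneVanishes S.X₃ Y) (g : S.X₁ ⟶ Y) : ∃ l : S.X₂ ⟶ Y, S.f ≫ l = g := by
  let : HasExt.{max u v} C := HasExt.standard C
  have h' : Subsingleton (Abelian.Ext.{max u v} S.X₃ Y 1) := h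
  obtain ⟨x, hx⟩ := Abelian.Ext.contravariant_sequence_exact₁ hS Y (Abelian.Ext.mk₀ g)
    (add_zero 1) (Subsingleton.elim _ _)
  obtain ⟨l, rfl⟩ := (Abelian.Ext.mk₀_bijective _ _).2 x
  refine ⟨l, (Abelian.Ext.mk₀_bijective _ _).1 ?_⟩
  rw [← hx, Abelian.Ext.mk₀_comp_mk₀]

/-- Since `Ext¹(S.X₂, Y) = 0`, every class comes from some `g` through the connecting map, which
kills the morphisms that extend to `S.X₂`. -/
lemma extOneVanishes_of_exists_extension {S : ShortComplex C} (hS : S.ShortExact)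
    [Projective S.X₂] {Y : C} (h : ∀ g : S.X₁ ⟶ Y, ∃ l : S.X₂ ⟶ Y, S.f ≫ l = g) :
    ExtOneVanishes S.X₃ Y := by
  let : HasExt.{max u v} C := HasExt.standard C
  have := Abelian.Ext.subsingleton_of_projective.{max u v} S.X₂ Y 0
  refine (subsingleton_of_forall_eq 0 fun x => ?_ : Subsingleton (Abelian.Ext.{max u v} S.X₃ Y 1))
  obtain ⟨y, rfl⟩ := Abelian.Ext.contravariant_sequence_exact₃ hS Y x
    (Subsingleton.elim _ _) (add_zero 1)
  obtain ⟨g, rfl⟩ := (Abelian.Ext.mk₀_bijective _ _).2 y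
  obtain ⟨l, rfl⟩ := h g
  rw [← Abelian.Ext.mk₀_comp_mk₀, ← Abelian.Ext.comp_assoc _ _ _ (add_zero 1) (add_zero 0) (by lia),
    hS.extClass_comp, Abelian.Ext.zero_comp]

lemma shortExact_kernel {A B : C} (p : A ⟶ B) [Epi p] :
    (ShortComplex.mk (kernel.ι p) p (kernel.condition p)).ShortExact where
  exact := ShortComplex.exact_of_f_is_kernel _ (kernelIsKernel p)

lemma shortExact_cokernel {A B : C} (i : A ⟶ B) [Mono i] :
    (ShortComplex.mk i (cokernel.π i) (cokernel.condition i)).ShortExact where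
  exact := ShortComplex.exact_of_g_is_cokernel _ (cokernelIsCokernel i)

/-- If every extension of `X` by `Y` splits, then `Ext¹(X, Y) = 0`. -/
lemma extOneVanishes_of_split [EnoughProjectives C] {X Y : C}
    (h : ∀ (E : C) (i : Y ⟶ E) (p : E ⟶ X) (w : i ≫ p = 0),
      (ShortComplex.mk i p w).ShortExact → ∃ s : X ⟶ E, s ≫ p = 𝟙 X) :
    ExtOneVanishes X Y := by
  let S := ShortComplex.mk _ _ (kernel.condition (Projective.π X))
  have hS : S.ShortExact := shortExact_kernel _
  have : Projective S.X₂ := inferInstanceAs (Projective (Projective.over X))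
  refine extOneVanishes_of_exists_extension hS fun g => ?_
  -- Pushing a projective presentation of `X` out along `g` gives an extension of `X` by `Y`; a
  -- splitting gives a retraction onto `Y`, hence an extension of `g`.
  let p : pushout S.f g ⟶ X := pushout.desc S.g 0 (by simp)
  have hp : pushout.inl S.f g ≫ p = S.g := pushout.inl_desc _ _ _
  have hp' : pushout.inr S.f g ≫ p = 0 := pushout.inr_desc _ _ _
  have : Mono S.f := hS.mono_f
  have : Epi S.g := hS.epi_g
  have : Epi (pushout.inl S.f g ≫ p) := by rw [hp]; infer_instance
  have : Epi p := epi_of_epi (pushout.inl S.f g) p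
  have hE : (ShortComplex.mk (pushout.inr S.f g) p hp').ShortExact := by
    refine { exact := ShortComplex.exact_of_g_is_cokernel _ ?_ }
    refine CokernelCofork.IsColimit.ofπ' _ _ fun {T} t ht => ?_
    have hk : S.f ≫ pushout.inl S.f g ≫ t = 0 := by
      rw [pushout.condition_assoc, ht, comp_zero]
    refine ⟨hS.exact.desc _ hk, ?_⟩
    apply pushout.hom_ext
    · rw [reassoc_of% hp]
      exact hS.exact.g_desc _ hk
    · rw [reassoc_of% hp', zero_comp, ht]
  obtain ⟨s, hs⟩ := h _ _ _ _ hE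
  have hr : (𝟙 _ - p ≫ s) ≫ p = 0 := by simp [hs]
  let r := hE.exact.lift _ hr
  have hrl : r ≫ pushout.inr S.f g = 𝟙 _ - p ≫ s := hE.exact.lift_f _ hr
  have : Mono (pushout.inr S.f g) := hE.mono_f
  refine ⟨pushout.inl S.f g ≫ r, ?_⟩
  rw [← cancel_mono (pushout.inr S.f g), pushout.condition_assoc, Category.assoc, Category.assoc,
    hrl, Preadditive.comp_sub, Category.comp_id, reassoc_of% hp', zero_comp, sub_zero]

lemma extOneVanishes_of_lift [EnoughProjectives C] {X Y : C}
    (h : ∀ (E : C) (p : E ⟶ X) [Epi p], Nonempty (kernel p ≅ Y) → ∃ s : X ⟶ E, s ≫ p = 𝟙 X) :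
    ExtOneVanishes X Y := by
  refine extOneVanishes_of_split fun E i p w hE => ?_
  have : Epi p := hE.epi_g
  exact h E p ⟨(kernelIsKernel p).conePointUniqueUpToIso hE.fIsKernel⟩

lemma ExtOneVanishes.of_retract {X X' Y : C} (h : ExtOneVanishes X' Y) (r : Retract X X') :
    ExtOneVanishes X Y := by
  let : HasExt.{max u v} C := HasExt.standard C
  have h' : Subsingleton (Abelian.Ext.{max u v} X' Y 1) := h
  refine (subsingleton_of_forall_eq 0 fun x => ?_ : Subsingleton (Abelian.Ext.{max u v} X Y 1))
  rw [← Abelian.Ext.mk₀_id_comp x, ← r.retract, ← Abelian.Ext.mk₀_comp_mk₀,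
    Abelian.Ext.comp_assoc _ _ _ (zero_add 0) (zero_add 1) (by lia),
    Subsingleton.elim ((Abelian.Ext.mk₀ r.r).comp x (zero_add 1)) 0, Abelian.Ext.comp_zero]

lemma ExtOneVanishes.of_iso_right {X Y Y' : C} (h : ExtOneVanishes X Y) (e : Y ≅ Y') :
    ExtOneVanishes X Y' := by
  let : HasExt.{max u v} C := HasExt.standard C
  have h' : Subsingleton (Abelian.Ext.{max u v} X Y 1) := h
  refine (subsingleton_of_forall_eq 0 fun x => ?_ : Subsingleton (Abelian.Ext.{max u v} X Y' 1))
  rw [← Abelian.Ext.comp_mk₀_id x, ← e.inv_hom_id, ← Abelian.Ext.mk₀_comp_mk₀,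
    ← Abelian.Ext.comp_assoc _ _ _ (add_zero 1) (add_zero 0) (by lia),
    Subsingleton.elim (x.comp (Abelian.Ext.mk₀ e.inv) (add_zero 1)) 0, Abelian.Ext.zero_comp]

lemma isCotorsionPair_leftPerp_rightPerp (P : ObjectProperty C) :
    IsCotorsionPair (leftPerp (rightPerp P)) (rightPerp P) where
  right_eq := le_antisymm (fun _ hY _ hX => hX _ hY)
    (fun _ hY X hX => hY X fun _ hZ => hZ X hX)
  left_eq := rfl

/-- The functorial short complex `A ⟶ Z A ⟶ cokernel` given by a natural transformation. -/
@[simps]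
def cokernelShortComplex {Z : C ⥤ C} (i : 𝟭 C ⟶ Z) : C ⥤ ShortComplex C where
  obj A := ShortComplex.mk (i.app A) (cokernel.π (i.app A)) (cokernel.condition _)
  map f :=
    { τ₁ := f
      τ₂ := Z.map f
      τ₃ := cokernel.map _ _ f (Z.map f) (i.naturality f).symm
      comm₁₂ := (i.naturality f) }

/-- The functorial short complex `kernel ⟶ Z A ⟶ A` given by a natural transformation. -/
@[simps]
def kernelShortComplex {Z : C ⥤ C} (p : Z ⟶ 𝟭 C) : C ⥤ ShortComplex C where
  obj A := ShortComplex.mk (kernel.ι (p.app A)) (p.app A) (kernel.condition _)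
  map f :=
    { τ₁ := kernel.map _ _ (Z.map f) f (p.naturality f).symm
      τ₂ := Z.map f
      τ₃ := f
      comm₂₃ := (p.naturality f) }

/-! ### The small object argument -/

section SmallObject

open MorphismProperty

/-- Cell attachments along monomorphisms are monomorphisms, and `Hom(A, -)` commutes with
`κ`-indexed colimits of monomorphisms once `κ` exceeds the number of subobjects of `A`. -/
lemma hasSmallObjectArgument_of_le_monomorphisms [IsGrothendieckAbelian.{w} C]
    (I : MorphismProperty C) [MorphismProperty.IsSmall.{w} I] (hI : I ≤ monomorphisms C) :
    HasSmallObjectArgument.{w} I := by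
  obtain ⟨κ, hκ', hκ⟩ := HasCardinalLT.exists_regular_cardinal_forall.{w}
    (fun f : I.toSet => Subobject f.1.left)
  have : Fact κ.IsRegular := ⟨hκ'⟩
  have : Nonempty κ.ord.ToType := by simpa using hκ'.ne_zero
  have := WellFoundedLT.toOrderBot κ.ord.ToType
  exact ⟨κ, inferInstance, inferInstance,
    { preservesColimit {A B X Y} i hi f hf := by
        let hf' : (monomorphisms C).TransfiniteCompositionOfShape κ.ord.ToType f :=
          { toTransfiniteCompositionOfShape := hf.toTransfiniteCompositionOfShape
            map_mem j hj := by
              have := (hf.attachCells j hj).pushouts_coproducts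
              simp only [ofHoms_homFamily] at this
              refine (?_ : _ ≤ monomorphisms C) _ this
              simp only [pushouts_le_iff, coproducts_le_iff]
              exact hI }
        have (j j' : κ.ord.ToType) (φ : j ⟶ j') : Mono (hf'.F.map φ) := hf'.mem_map φ
        exact IsGrothendieckAbelian.preservesColimit_coyoneda_obj_of_mono (Y := hf'.F) (κ := κ)
          (hκ ⟨Arrow.mk i, hi⟩) }⟩

end SmallObject

/-! ### Approximation sequences from functorial factorizations -/

section Completeness

/-- The morphisms `kernel (P ⟶ S) ⟶ P` for the projective covers `P` of the members `S` of a
family, together with `0 ⟶ Q`. -/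
def generatingCofibrations [EnoughProjectives C] {T : Type w} (S : T → C) (Q : C) :
    MorphismProperty C :=
  MorphismProperty.ofHoms (fun t : T => kernel.ι (Projective.π (S t))) ⊔
    MorphismProperty.ofHoms (fun _ : PUnit.{w + 1} => (0 : (0 : C) ⟶ Q))

variable [EnoughProjectives C] {T : Type w} (S : T → C) (Q : C)

lemma generatingCofibrations_le_monomorphisms :
    generatingCofibrations S Q ≤ MorphismProperty.monomorphisms C := by
  rintro _ _ _ (⟨⟨t⟩⟩ | ⟨⟨⟩⟩)
  · exact inferInstanceAs (Mono (kernel.ι (Projective.π (S t))))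
  · exact inferInstanceAs (Mono (0 : (0 : C) ⟶ Q))

instance : MorphismProperty.IsSmall.{w} (generatingCofibrations S Q) := by
  rw [MorphismProperty.isSmall_iff_eq_ofHoms]
  refine ⟨T ⊕ PUnit.{w + 1}, Sum.elim (fun t => kernel (Projective.π (S t))) (fun _ => 0),
    Sum.elim (fun t => Projective.over (S t)) (fun _ => Q), fun t => match t with
      | Sum.inl t => kernel.ι (Projective.π (S t))
      | Sum.inr _ => 0, ?_⟩
  apply le_antisymm
  · rintro _ _ _ (⟨⟨t⟩⟩ | ⟨⟨⟩⟩)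
    · exact ⟨Sum.inl t⟩
    · exact ⟨Sum.inr PUnit.unit⟩
  · rintro _ _ _ ⟨t | ⟨⟩⟩
    · exact Or.inl ⟨t⟩
    · exact Or.inr ⟨PUnit.unit⟩

variable {S Q}

/-- A lift of `b` through `p` exists by projectivity. Its failure to restrict to `a` is a morphism
into `kernel p`, which extends because `Ext¹` vanishes and so corrects the lift. -/
lemma rlp_generatingCofibrations_of_ext [Projective Q] {E B : C} (p : E ⟶ B) [Epi p]
    (h : ∀ t, ExtOneVanishes (S t) (kernel p)) : (generatingCofibrations S Q).rlp p := by
  have hp := shortExact_kernel p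
  rintro _ _ _ (⟨⟨t⟩⟩ | ⟨⟨⟩⟩)
  · constructor
    intro a b sq
    let b' := Projective.factorThru b p
    have hw : (a - kernel.ι _ ≫ b') ≫ p = 0 := by
      simp [b', sq.w]
    obtain ⟨l, hl⟩ := ExtOneVanishes.exists_extension (shortExact_kernel (Projective.π (S t)))
      (h t) (kernel.lift p _ hw)
    dsimp at hl
    refine ⟨⟨⟨b' + l ≫ kernel.ι p, ?_, ?_⟩⟩⟩
    · rw [Preadditive.comp_add, reassoc_of% hl, kernel.lift_ι]
      abel
    · simp [b']
  · constructor
    intro a b sq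
    exact ⟨⟨⟨Projective.factorThru b p, (isZero_zero C).eq_of_src _ _, by simp⟩⟩⟩

/-- Lifting against `0 ⟶ Q` factors every morphism from the separator `Q` through `p`. -/
lemma epi_of_rlp_generatingCofibrations (hQ : IsSeparator Q) {E B : C} {p : E ⟶ B}
    (hp : (generatingCofibrations S Q).rlp p) : Epi p := by
  refine Preadditive.epi_of_cancel_zero _ fun {Z} g hg => ?_
  refine (isSeparator_def Q).1 hQ _ _ fun q => ?_
  have := hp (0 : (0 : C) ⟶ Q) (Or.inr ⟨PUnit.unit⟩)
  have sq : CommSq (0 : (0 : C) ⟶ E) (0 : (0 : C) ⟶ Q) p q := ⟨by simp⟩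
  rw [← sq.fac_right, Category.assoc, hg, comp_zero, comp_zero]

lemma ext_of_rlp_generatingCofibrations {Y : C}
    (hp : (generatingCofibrations S Q).rlp (0 : Y ⟶ 0)) (t : T) : ExtOneVanishes (S t) Y := by
  have : Projective (ShortComplex.mk _ _ (kernel.condition (Projective.π (S t)))).X₂ :=
    inferInstanceAs (Projective (Projective.over (S t)))
  refine extOneVanishes_of_exists_extension (shortExact_kernel (Projective.π (S t))) fun g => ?_
  have := hp (kernel.ι (Projective.π (S t))) (Or.inl ⟨t⟩)
  have sq : CommSq g (kernel.ι (Projective.π (S t))) (0 : Y ⟶ 0) 0 := ⟨by simp⟩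
  exact ⟨sq.lift, sq.fac_left⟩

/-- The morphism `kernel p ⟶ 0` is a base change of `p`, so it inherits the lifting property. -/
lemma ext_kernel_of_rlp_generatingCofibrations {E B : C} {p : E ⟶ B}
    (hp : (generatingCofibrations S Q).rlp p) (t : T) : ExtOneVanishes (S t) (kernel p) := by
  refine ext_of_rlp_generatingCofibrations (Q := Q) ?_ t
  have h : IsPullback (kernel.ι p) 0 p (0 : 0 ⟶ B) :=
    ⟨⟨by simp⟩, ⟨PullbackCone.IsLimit.mk _ (fun s => kernel.lift p s.fst (by
      rw [s.condition, comp_zero])) (by simp) (fun s => (isZero_zero C).eq_of_tgt _ _)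
      (fun s m h₁ h₂ => by simp [← cancel_mono (kernel.ι p), h₁])⟩⟩
  exact MorphismProperty.of_isPullback h hp

/-- The cokernel of a morphism with the left lifting property against all morphisms with the right
lifting property with respect to the generating cofibrations is left orthogonal to every object
which is right orthogonal to the family. -/
lemma ext_cokernel_of_llp_rlp [Projective Q] {A B : C} {i : A ⟶ B}
    (hi : (generatingCofibrations S Q).rlp.llp i) {Y : C} (hY : ∀ t, ExtOneVanishes (S t) Y) :
    ExtOneVanishes (cokernel i) Y := by
  refine extOneVanishes_of_lift fun E p _ ⟨e⟩ => ?_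
  have := hi p (rlp_generatingCofibrations_of_ext p fun t => (hY t).of_iso_right e.symm)
  -- The lift restricts to zero on `A`, so it descends to a section of `p`.
  have sq : CommSq (0 : A ⟶ E) i p (cokernel.π i) := ⟨by simp⟩
  refine ⟨cokernel.desc i sq.lift sq.fac_left, ?_⟩
  rw [← cancel_epi (cokernel.π i), cokernel.π_desc_assoc, sq.fac_right, Category.comp_id]

/-- The generators are monomorphisms, and in a Grothendieck category the monomorphisms are already
closed under `rlp.llp`. -/
lemma mono_of_llp_rlp [IsGrothendieckAbelian.{w} C] {A B : C} {i : A ⟶ B}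
    (hi : (generatingCofibrations S Q).rlp.llp i) : Mono i := by
  have h := IsGrothendieckAbelian.llp_rlp_monomorphisms (isSeparator_separator C)
  refine (?_ : MorphismProperty.monomorphisms C i)
  rw [← h]
  exact MorphismProperty.antitone_llp (MorphismProperty.antitone_rlp
    (generatingCofibrations_le_monomorphisms S Q)) _ hi

/-- The cotorsion pair cogenerated by an essentially small class in a Grothendieck abelian
category with enough projectives is functorially complete. -/
theorem isFunctoriallyCompleteCotorsionPair_of_essentiallySmall [IsGrothendieckAbelian.{w} C]
    (P : ObjectProperty C) [ObjectProperty.EssentiallySmall.{w} P] :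
    IsFunctoriallyCompleteCotorsionPair (leftPerp (rightPerp P)) (rightPerp P) := by
  obtain ⟨P₀, _, hP₀, hP⟩ := ObjectProperty.EssentiallySmall.exists_small_le.{w} P
  let S : Shrink.{w} (Subtype P₀) → C := fun t => ((equivShrink _).symm t).1
  have hS : ∀ t, P (S t) := fun t => hP₀ _ ((equivShrink _).symm t).2
  have hperp : ∀ {Y : C}, rightPerp P Y ↔ ∀ t, ExtOneVanishes (S t) Y := by
    refine fun {Y} => ⟨fun h t => h _ (hS t), fun h X hX => ?_⟩
    obtain ⟨X₀, h₀, ⟨e⟩⟩ := hP _ hX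
    have := h (equivShrink _ ⟨X₀, h₀⟩)
    simp only [S, Equiv.symm_apply_apply] at this
    exact this.of_retract (Retract.ofIso e)
  -- Projectivity gives lifts of `0 ⟶ Q` against epimorphisms; being a separator makes morphisms
  -- with the lifting property epimorphisms.
  let Q := Projective.over (separator C)
  have hQ : IsSeparator Q := by
    rw [isSeparator_def]
    intro X Y f g h
    refine (isSeparator_def _).1 (isSeparator_separator C) _ _ fun k => ?_
    rw [← cancel_epi (Projective.π (separator C)), ← Category.assoc, ← Category.assoc, h]
  have hI : MorphismProperty.HasSmallObjectArgument.{w} (generatingCofibrations S Q) :=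
    hasSmallObjectArgument_of_le_monomorphisms _ (generatingCofibrations_le_monomorphisms S Q)
  let data := MorphismProperty.functorialFactorizationData
    (generatingCofibrations S Q).rlp.llp (generatingCofibrations S Q).rlp
  refine ⟨isCotorsionPair_leftPerp_rightPerp P, ?_, ?_⟩
  -- Factor `A ⟶ 0`: the middle object is right orthogonal, the cokernel of the first factor left
  -- orthogonal.
  · let toZero : C ⥤ Arrow C :=
      { obj A := Arrow.mk (0 : A ⟶ 0)
        map f := Arrow.homMk f 0 }
    let i : 𝟭 C ⟶ toZero ⋙ data.Z :=
      { app A := data.i.app (toZero.obj A)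
        naturality _ _ f := data.i.naturality (toZero.map f) }
    have hi : ∀ A, (generatingCofibrations S Q).rlp.llp (i.app A) :=
      fun A => data.hi (toZero.obj A)
    refine ⟨cokernelShortComplex i, ⟨Iso.refl _⟩, fun A => ?_⟩
    have := mono_of_llp_rlp (hi A)
    have hp : (generatingCofibrations S Q).rlp (data.p.app (toZero.obj A)) := data.hp _
    have h0 : data.p.app (toZero.obj A) = 0 := (isZero_zero C).eq_of_tgt _ _
    rw [h0] at hp
    refine ⟨shortExact_cokernel (i.app A), hperp.2 (ext_of_rlp_generatingCofibrations (Q := Q)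
      hp), fun Y hY => ext_cokernel_of_llp_rlp (hi A) (hperp.1 hY)⟩
  -- Factor `0 ⟶ A`: the middle object is the cokernel of its first factor, hence left orthogonal,
  -- and the kernel of the second factor is right orthogonal.
  · let fromZero : C ⥤ Arrow C :=
      { obj A := Arrow.mk (0 : 0 ⟶ A)
        map f := Arrow.homMk 0 f }
    let p : fromZero ⋙ data.Z ⟶ 𝟭 C :=
      { app A := data.p.app (fromZero.obj A)
        naturality _ _ f := data.p.naturality (fromZero.map f) }
    have hp : ∀ A, (generatingCofibrations S Q).rlp (p.app A) :=
      fun A => data.hp (fromZero.obj A)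
    refine ⟨kernelShortComplex p, ⟨Iso.refl _⟩, fun A => ?_⟩
    have := epi_of_rlp_generatingCofibrations hQ (hp A)
    refine ⟨shortExact_kernel (p.app A), hperp.2 (ext_kernel_of_rlp_generatingCofibrations (hp A)),
      fun Y hY => ?_⟩
    have hi : (generatingCofibrations S Q).rlp.llp (data.i.app (fromZero.obj A)) :=
      data.hi (fromZero.obj A)
    have h0 : data.i.app (fromZero.obj A) = 0 := (isZero_zero C).eq_of_src _ _
    rw [h0] at hi
    exact (ext_cokernel_of_llp_rlp hi (hperp.1 hY)).of_retract (Retract.ofIso cokernelZeroIsoTarget.symm)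

end Completeness

end Abelian

/-! ### Contractible complexes and enough projectives -/

section Contractible

variable {C : Type u} [Category.{v} C]

lemma projective_sigma {ι : Type w} (G : ι → C) [HasCoproduct G] (hG : ∀ i, Projective (G i)) :
    Projective (∐ G) where
  factors f e _ := ⟨Sigma.desc fun i => Projective.factorThru (Sigma.ι G i ≫ f) e, by
    ext i
    simp⟩

variable [Abelian C]

/-- The contractible complex with `A ⊞ A` in each degree and differential `(a, b) ↦ (b, 0)`. -/
abbrev contractible (A : C) : ChainComplex C ℤ where
  X _ := A ⊞ A
  d i j := if j + 1 = i then biprod.snd ≫ biprod.inl else 0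
  shape i j h := if_neg h
  d_comp_d' i j k h₁ h₂ := by
    simp only [ComplexShape.down_Rel] at h₁ h₂
    simp [h₁, h₂]

lemma contractible_d (A : C) {i j : ℤ} (h : j + 1 = i) :
    (contractible A).d i j = (biprod.snd ≫ biprod.inl : A ⊞ A ⟶ A ⊞ A) := if_pos h

/-- The morphism from `contractible A` given by a family of morphisms `A ⟶ K.X i`. -/
def fromContractible {A : C} {K : ChainComplex C ℤ} (b : ∀ i, A ⟶ K.X i) :
    contractible A ⟶ K where
  f i := (biprod.desc (b (i + 1) ≫ K.d (i + 1) i) (b i) : A ⊞ A ⟶ K.X i)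
  comm' i j h := by
    obtain rfl : j + 1 = i := h
    refine biprod.hom_ext' _ _ ?_ ?_ <;> simp

lemma inr_fromContractible_f {A : C} {K : ChainComplex C ℤ} (b : ∀ i, A ⟶ K.X i) (i : ℤ) :
    (biprod.inr : A ⟶ A ⊞ A) ≫ (fromContractible b).f i = b i :=
  biprod.inr_desc _ _

/-- The differential identifies the second summand in degree `i + 1` with the first in degree `i`,
so the second summands determine a morphism. -/
lemma fromContractible_ext {A : C} {K : ChainComplex C ℤ} {φ ψ : contractible A ⟶ K}
    (h : ∀ i, (biprod.inr : A ⟶ A ⊞ A) ≫ φ.f i = (biprod.inr : A ⟶ A ⊞ A) ≫ ψ.f i) : φ = ψ := by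
  have key : ∀ (χ : contractible A ⟶ K) (i : ℤ), (biprod.inl : A ⟶ A ⊞ A) ≫ χ.f i =
      (biprod.inr : A ⟶ A ⊞ A) ≫ χ.f (i + 1) ≫ K.d (i + 1) i := by
    intro χ i
    rw [χ.comm, contractible_d _ rfl]
    simp
  refine HomologicalComplex.hom_ext _ _ fun i => biprod.hom_ext' _ _ ?_ (h i)
  rw [key, key, reassoc_of% (h (i + 1))]

instance projective_contractible (P : C) [Projective P] : Projective (contractible P) where
  factors {E B} φ e _ := by
    refine ⟨fromContractible fun i =>
      Projective.factorThru ((biprod.inr : P ⟶ P ⊞ P) ≫ φ.f i) (e.f i), ?_⟩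
    refine fromContractible_ext fun i => ?_
    rw [HomologicalComplex.comp_f, ← Category.assoc, inr_fromContractible_f,
      Projective.factorThru_comp]

instance enoughProjectives_chainComplex [EnoughProjectives C] [HasCoproductsOfShape ℤ C] :
    EnoughProjectives (ChainComplex C ℤ) where
  presentation K := by
    have hP : Projective (∐ fun n : ℤ => Projective.over (K.X n)) :=
      projective_sigma _ inferInstance
    -- A single projective must cover all components at once, since `contractible` uses the same
    -- object in every degree.
    let P : C := ∐ fun n : ℤ => Projective.over (K.X n)
    let b : ∀ n, P ⟶ K.X n := fun n => Sigma.π _ n ≫ Projective.π (K.X n)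
    have hb : ∀ n, Epi (b n) := fun n => epi_comp _ _
    have (n : ℤ) : Epi ((fromContractible b).f n) := by
      have : Epi ((biprod.inr : P ⟶ P ⊞ P) ≫ (fromContractible b).f n) := by
        rw [inr_fromContractible_f]
        infer_instance
      exact epi_of_epi (biprod.inr : P ⟶ P ⊞ P) _
    exact ⟨{ p := contractible P, f := fromContractible b, projective := projective_contractible P,
             epi := HomologicalComplex.epi_of_epi_f _ inferInstance }⟩

/-- The morphism to `contractible A` given by a family of morphisms `K.X i ⟶ A`. -/
def toContractible {A : C} {K : ChainComplex C ℤ} (g : ∀ i, K.X i ⟶ A) :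
    K ⟶ contractible A where
  f i := (biprod.lift (g i) (K.d i (i - 1) ≫ g (i - 1)) : K.X i ⟶ A ⊞ A)
  comm' i j h := by
    obtain rfl : j + 1 = i := h
    rw [contractible_d _ rfl]
    obtain ⟨k, hk⟩ : ∃ k, k = j + 1 - 1 := ⟨_, rfl⟩
    rw [← hk]
    obtain rfl : k = j := by lia
    refine biprod.hom_ext _ _ ?_ ?_ <;> simp

/-- The functoriality of `contractible`. -/
def contractibleMap {A B : C} (f : A ⟶ B) : contractible A ⟶ contractible B where
  f _ := biprod.map f f
  comm' i j h := by
    rw [contractible_d _ h, contractible_d _ h]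
    simp

lemma shortExact_contractible {S : ShortComplex C} (hS : S.ShortExact) :
    (ShortComplex.mk (contractibleMap S.f) (contractibleMap S.g) (by
      refine HomologicalComplex.hom_ext _ _ fun i => ?_
      change biprod.map S.f S.f ≫ biprod.map S.g S.g = 0
      ext <;> simp)).ShortExact := by
  have := hS.mono_f
  have := hS.epi_g
  refine HomologicalComplex.shortExact_of_degreewise_shortExact _ fun i => ?_
  have hm : Mono (biprod.map S.f S.f) := inferInstance
  have he : Epi (biprod.map S.g S.g) := inferInstance
  refine { exact := ?_, mono_f := hm, epi_g := he }
  · refine @ShortComplex.exact_of_f_is_kernel _ _ _ _ (@KernelFork.IsLimit.ofι' _ _ _ _ _ _ _ _ _ (fun {T} t ht => ?_) hm) _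
    change T ⟶ S.X₂ ⊞ S.X₂ at t
    change t ≫ biprod.map S.g S.g = 0 at ht
    have h₁ : (t ≫ biprod.fst) ≫ S.g = 0 := by
      have := ht =≫ biprod.fst
      simpa using this
    have h₂ : (t ≫ biprod.snd) ≫ S.g = 0 := by
      have := ht =≫ biprod.snd
      simpa using this
    refine ⟨biprod.lift (hS.exact.lift _ h₁) (hS.exact.lift _ h₂), ?_⟩
    change _ ≫ biprod.map S.f S.f = t
    ext <;> simp

end Contractible

/-! ### Degreewise split extensions as cocycles -/

section Cocycle

variable {C : Type u} [Category.{v} C] [Abelian C]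

/-- A family of morphisms `X.X i ⟶ Y.X (i - 1)` which twists the differential of the direct sum
of the complexes `Y` and `X`. -/
structure ExtCocycle (X Y : ChainComplex C ℤ) where
  /-- the family of morphisms -/
  f (i j : ℤ) : X.X i ⟶ Y.X j
  shape (i j : ℤ) (h : j + 1 ≠ i) : f i j = 0
  comp (i j k : ℤ) (hij : j + 1 = i) (hjk : k + 1 = j) :
    f i j ≫ Y.d j k + X.d i j ≫ f j k = 0

namespace ExtCocycle

variable {X Y : ChainComplex C ℤ} (f : ExtCocycle X Y)

/-- A cocycle is a coboundary if it comes from a family of morphisms `X.X i ⟶ Y.X i`. -/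
def IsCoboundary : Prop :=
  ∃ h : ∀ i, X.X i ⟶ Y.X i, ∀ i j, j + 1 = i → f.f i j = h i ≫ Y.d i j - X.d i j ≫ h j

/-- The extension of `X` by `Y` given by a cocycle. -/
abbrev extension : ChainComplex C ℤ where
  X n := Y.X n ⊞ X.X n
  d i j := biprod.map (Y.d i j) (X.d i j) + biprod.snd ≫ f.f i j ≫ biprod.inl
  shape i j h := by
    rw [Y.shape _ _ h, X.shape _ _ h, f.shape _ _ h]
    ext <;> simp
  d_comp_d' i j k hij hjk := by
    have := f.comp i j k hij hjk
    ext <;> simp [this]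

/-- The inclusion in the extension given by a cocycle. -/
@[simps]
def extensionInl : Y ⟶ f.extension where
  f n := biprod.inl
  comm' i j _ := by ext <;> simp

/-- The projection from the extension given by a cocycle. -/
@[simps]
def extensionSnd : f.extension ⟶ X where
  f n := biprod.snd
  comm' i j _ := by ext <;> simp

lemma extensionInl_extensionSnd : f.extensionInl ≫ f.extensionSnd = 0 := by
  ext n
  simp

lemma shortExact_extension :
    (ShortComplex.mk _ _ f.extensionInl_extensionSnd).ShortExact := by
  refine HomologicalComplex.shortExact_of_degreewise_shortExact _ fun i => ?_
  exact ShortComplex.Splitting.shortExact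
    { r := (biprod.fst : Y.X i ⊞ X.X i ⟶ _)
      s := (biprod.inr : _ ⟶ Y.X i ⊞ X.X i)
      f_r := biprod.inl_fst
      s_g := biprod.inr_snd
      id := biprod.total }

/-- A section of the twisted extension has a component `X.X i ⟶ Y.X i`; its negative is the required
cochain. -/
lemma isCoboundary_of_extOneVanishes (h : ExtOneVanishes X Y) : f.IsCoboundary := by
  obtain ⟨s, hs⟩ := ExtOneVanishes.exists_lift f.shortExact_extension h (𝟙 X)
  dsimp only at s hs
  refine ⟨fun i => - (s.f i ≫ biprod.fst), fun i j _ => ?_⟩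
  have h₁ : s.f i ≫ biprod.snd = 𝟙 _ := by
    have := congr_arg (fun φ => HomologicalComplex.Hom.f φ i) hs
    simpa using this
  have h₂ := s.comm i j =≫ biprod.fst
  simp [reassoc_of% h₁] at h₂
  simp [← h₂]

end ExtCocycle

/-- Degreewise sections exist by projectivity. Their defect from commuting with the differentials is
a cocycle with values in `Y`, and a cochain bounding it corrects them to a chain map. -/
lemma extOneVanishes_of_isCoboundary [EnoughProjectives (ChainComplex C ℤ)]
    {X Y : ChainComplex C ℤ} [∀ n, Projective (X.X n)]
    (h : ∀ f : ExtCocycle X Y, f.IsCoboundary) : ExtOneVanishes X Y := by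
  refine extOneVanishes_of_split fun E ι p w hE => ?_
  have hEn (n : ℤ) := hE.map_of_exact (HomologicalComplex.eval C _ n)
  have (n : ℤ) : Epi (p.f n) := (hEn n).epi_g
  have (n : ℤ) : Mono (ι.f n) := (hEn n).mono_f
  let s (n : ℤ) : X.X n ⟶ E.X n := Projective.factorThru (𝟙 _) (p.f n)
  have hs (n : ℤ) : s n ≫ p.f n = 𝟙 _ := Projective.factorThru_comp _ _
  have hw (i j : ℤ) : (s i ≫ E.d i j - X.d i j ≫ s j) ≫ p.f j = 0 := by
    rw [Preadditive.sub_comp, Category.assoc, Category.assoc, ← p.comm, reassoc_of% (hs i), hs,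
      Category.comp_id, sub_self]
  have (n : ℤ) : Mono (((ShortComplex.mk ι p w).map (HomologicalComplex.eval C _ n)).f) :=
    (hEn n).mono_f
  let g (i j : ℤ) : X.X i ⟶ Y.X j := (hEn j).exact.lift _ (hw i j)
  have hg (i j : ℤ) : g i j ≫ ι.f j = s i ≫ E.d i j - X.d i j ≫ s j :=
    (hEn j).exact.lift_f _ (hw i j)
  obtain ⟨h, hh⟩ := h
    { f := g
      shape i j hij := by
        rw [← cancel_mono (ι.f j), hg, E.shape _ _ hij, X.shape _ _ hij]
        simp
      comp i j k _ _ := by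
        rw [← cancel_mono (ι.f k), Preadditive.add_comp, Category.assoc, Category.assoc, hg,
          ← ι.comm, reassoc_of% (hg i j)]
        simp }
  dsimp only at hh
  refine ⟨{ f n := s n - h n ≫ ι.f n, comm' i j hij := ?_ }, ?_⟩
  · have := hh i j hij =≫ ι.f j
    rw [hg, Preadditive.sub_comp, Category.assoc, Category.assoc, ← ι.comm] at this
    rw [Preadditive.sub_comp, Preadditive.comp_sub, Category.assoc, sub_eq_sub_iff_sub_eq_sub]
    exact this
  · ext n
    have hιp : ι.f n ≫ p.f n = 0 := by rw [← HomologicalComplex.comp_f, w]; rfl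
    simp [hs, hιp]

/-- The contractible complexes are right orthogonal to the complexes of projectives. -/
lemma extOneVanishes_contractible [EnoughProjectives (ChainComplex C ℤ)] (X : ChainComplex C ℤ)
    [∀ n, Projective (X.X n)] (A : C) : ExtOneVanishes X (contractible A) := by
  refine extOneVanishes_of_isCoboundary fun f => ?_
  -- A contracting homotopy: `t ≫ d + d ≫ t = 𝟙`, so composing the cocycle with `t` bounds it.
  let t : A ⊞ A ⟶ A ⊞ A := biprod.fst ≫ biprod.inr
  let g (i j : ℤ) : X.X i ⟶ A ⊞ A := f.f i j
  have hg (i j k : ℤ) (hij : j + 1 = i) (hjk : k + 1 = j) :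
      X.d i j ≫ g j k = - (g i j ≫ (biprod.snd ≫ biprod.inl : A ⊞ A ⟶ A ⊞ A)) := by
    have := f.comp i j k hij hjk
    rw [contractible_d _ hjk] at this
    exact eq_neg_of_add_eq_zero_right this
  have ht : (biprod.fst ≫ biprod.inr : A ⊞ A ⟶ A ⊞ A) ≫ biprod.snd ≫ biprod.inl +
      (biprod.snd ≫ biprod.inl : A ⊞ A ⟶ A ⊞ A) ≫ biprod.fst ≫ biprod.inr = 𝟙 (A ⊞ A) := by
    ext <;> simp
  refine ⟨fun i => (g i (i - 1) ≫ t : X.X i ⟶ A ⊞ A), fun i j hij => ?_⟩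
  obtain rfl : i - 1 = j := by lia
  rw [contractible_d _ hij, reassoc_of% (hg i (i - 1) (i - 1 - 1) hij (by lia))]
  have := g i (i - 1) ≫= ht
  simp only [Preadditive.comp_add, Category.comp_id, Category.assoc] at this
  simp only [t, Category.assoc, Preadditive.neg_comp, sub_neg_eq_add]
  exact this.symm

/-- A complex whose first extension groups with values in contractible complexes vanish consists of
projective objects. -/
lemma projective_of_extOneVanishes_contractible {X : ChainComplex C ℤ}
    (h : ∀ A : C, ExtOneVanishes X (contractible A)) (n : ℤ) : Projective (X.X n) where
  factors {E B} φ e _ := by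
    -- The family equal to `φ` in degree `n` and zero elsewhere is a chain map to `contractible B`;
    -- the first coordinate in degree `n` of its lift to `contractible E` lifts `φ`.
    obtain ⟨l, hl⟩ := ExtOneVanishes.exists_lift (shortExact_contractible (shortExact_kernel e))
      (h (kernel e)) (toContractible (A := B) fun i =>
        if h : i = n then eqToHom (by rw [h]) ≫ φ else 0)
    dsimp only at l hl
    refine ⟨(l.f n : X.X n ⟶ E ⊞ E) ≫ biprod.fst, ?_⟩
    have := congr_arg (fun ψ => HomologicalComplex.Hom.f ψ n) hl
    have : (l.f n : X.X n ⟶ E ⊞ E) ≫ biprod.map e e = biprod.lift _ _ := this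
    have := this =≫ biprod.fst
    simpa using this

end Cocycle

/-! ### Trivializing cocycles by Zorn's lemma -/

section FiniteSupport

variable {C : Type u} [Category.{v} C] [Abelian C]

/-- A decomposition of the components of a complex as coproducts, such that the restriction of the
differential to each summand is supported on finitely many summands. -/
structure FiniteDecomposition (X : ChainComplex C ℤ) where
  /-- the indices of the summands -/
  I (n : ℤ) : Type w
  /-- the summands -/
  G (n : ℤ) (a : I n) : C
  /-- the inclusions of the summands -/
  ι (n : ℤ) (a : I n) : G n a ⟶ X.X n
  /-- the components are coproducts -/
  isColimit (n : ℤ) : IsColimit (Cofan.mk (X.X n) (ι n))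
  /-- the support of the differential -/
  supp {i : ℤ} (j : ℤ) (a : I i) : Set (I j)
  finite_supp {i : ℤ} (j : ℤ) (a : I i) : (supp j a).Finite
  eq_of_supp {i j : ℤ} (a : I i) {Z : C} (g g' : X.X j ⟶ Z)
    (h : ∀ b ∈ supp j a, ι j b ≫ g = ι j b ≫ g') : ι i a ≫ X.d i j ≫ g = ι i a ≫ X.d i j ≫ g'

namespace FiniteDecomposition

variable {X : ChainComplex C ℤ} (D : FiniteDecomposition.{v, u, w} X)

lemma hom_ext {n : ℤ} {Z : C} {g g' : X.X n ⟶ Z} (h : ∀ a, D.ι n a ≫ g = D.ι n a ≫ g') :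
    g = g' :=
  Cofan.IsColimit.hom_ext (D.isColimit n) _ _ h

/-- The morphism from a component given by its restrictions to the summands. -/
def desc {n : ℤ} {Z : C} (φ : ∀ a, D.G n a ⟶ Z) : X.X n ⟶ Z :=
  Cofan.IsColimit.desc (D.isColimit n) φ

@[simp]
lemma ι_desc {n : ℤ} {Z : C} (φ : ∀ a, D.G n a ⟶ Z) (a : D.I n) : D.ι n a ≫ D.desc φ = φ a :=
  Cofan.IsColimit.fac (D.isColimit n) φ a

/-- A set of summands which is closed under taking supports of the differential. -/
def IsClosed (J : ∀ n, Set (D.I n)) : Prop :=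
  ∀ i j, j + 1 = i → ∀ a ∈ J i, D.supp j a ⊆ J j

/-- The summands which are needed for the differential of a given one. -/
def reach (x : Σ n, D.I n) (n : ℤ) : Set (D.I n) :=
  {a | Relation.ReflTransGen (fun y z : Σ n, D.I n => z.1 + 1 = y.1 ∧ z.2 ∈ D.supp z.1 y.2) x ⟨n, a⟩}

lemma isClosed_reach (x : Σ n, D.I n) : D.IsClosed (D.reach x) :=
  fun _ _ hij _ ha _ hb => ha.tail ⟨hij, hb⟩

lemma mem_reach_self (x : Σ n, D.I n) : x.2 ∈ D.reach x x.1 := Relation.ReflTransGen.refl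

lemma le_of_mem_reach {x : Σ n, D.I n} {n : ℤ} {a : D.I n} (h : a ∈ D.reach x n) : n ≤ x.1 := by
  suffices ∀ y : Σ n, D.I n, Relation.ReflTransGen
      (fun y z : Σ n, D.I n => z.1 + 1 = y.1 ∧ z.2 ∈ D.supp z.1 y.2) x y → y.1 ≤ x.1 from this _ h
  intro y hy
  induction hy with
  | refl => exact le_rfl
  | tail _ h ih => have := h.1; lia

/-- Each step lowers the degree by exactly one, so the top degree contains only `x`, and each lower
degree lies in a finite union of finite supports. -/
lemma finite_reach (x : Σ n, D.I n) (n : ℤ) : (D.reach x n).Finite := by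
  by_cases hn : n ≤ x.1
  · induction n, hn using Int.leInductionDown with
    | base =>
      refine (Set.finite_singleton x.2).subset fun a ha => ?_
      obtain h | ⟨y, hy, h⟩ := Relation.ReflTransGen.cases_tail ha
      · obtain ⟨n, b⟩ := x
        cases h
        rfl
      · have := D.le_of_mem_reach (a := y.2) hy
        have := h.1
        dsimp at this
        lia
    | pred n hn ih =>
      refine (ih.biUnion fun a _ => D.finite_supp (n - 1) a).subset fun a ha => ?_
      obtain h | ⟨⟨m, b⟩, hy, h⟩ := Relation.ReflTransGen.cases_tail ha
      · have : n - 1 = x.1 := congr_arg Sigma.fst h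
        lia
      · obtain ⟨h₁, h₂⟩ := h
        dsimp only at h₁ h₂
        obtain rfl : m = n := by lia
        exact Set.mem_biUnion hy h₂
  · exact Set.finite_empty.subset fun a ha => hn (D.le_of_mem_reach ha)

end FiniteDecomposition

namespace FiniteDecomposition

variable {X Y : ChainComplex C ℤ} (D : FiniteDecomposition.{v, u, w} X) (f : ExtCocycle X Y)

/-- Twisting a cocycle by a coboundary. -/
@[simps]
def _root_.CotorsionPairs.ExtCocycle.twist (h : ∀ n, X.X n ⟶ Y.X n) : ExtCocycle X Y where
  f i j := f.f i j - (h i ≫ Y.d i j - X.d i j ≫ h j)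
  shape i j hij := by simp [f.shape i j hij, Y.shape _ _ hij, X.shape _ _ hij]
  comp i j k hij hjk := by
    have := f.comp i j k hij hjk
    simp only [Preadditive.sub_comp, Preadditive.comp_sub, Category.assoc,
      HomologicalComplex.d_comp_d, HomologicalComplex.d_comp_d_assoc, comp_zero, zero_comp]
    rw [← this]
    abel

section Subquotient

variable [HasCoproducts.{w} C] {n : ℤ}

/-- The inclusion of a partial coproduct. -/
def incl (K : Set (D.I n)) : (∐ fun a : K => D.G n a) ⟶ X.X n :=
  Sigma.desc fun a => D.ι n a

open Classical in
/-- The projection to a partial coproduct. -/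
def proj (K : Set (D.I n)) : X.X n ⟶ ∐ fun a : K => D.G n a :=
  D.desc fun a => if h : a ∈ K then Sigma.ι (fun a : K => D.G n a) ⟨a, h⟩ else 0

lemma ι_incl {K : Set (D.I n)} (a : K) :
    Sigma.ι (fun a : K => D.G n a) a ≫ D.incl K = D.ι n a := by
  simp [incl]

lemma ι_incl_assoc {K : Set (D.I n)} (a : K) {Z : C} (g : X.X n ⟶ Z) :
    Sigma.ι (fun a : K => D.G n a) a ≫ D.incl K ≫ g = D.ι n a ≫ g := by
  rw [← Category.assoc, ι_incl]

lemma ι_proj_of_mem {K : Set (D.I n)} {a : D.I n} (h : a ∈ K) :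
    D.ι n a ≫ D.proj K = Sigma.ι (fun a : K => D.G n a) ⟨a, h⟩ := by
  simp [proj, h]

lemma ι_proj_of_mem_assoc {K : Set (D.I n)} {a : D.I n} (h : a ∈ K) {Z : C}
    (g : (∐ fun a : K => D.G n a) ⟶ Z) :
    D.ι n a ≫ D.proj K ≫ g = Sigma.ι (fun a : K => D.G n a) ⟨a, h⟩ ≫ g := by
  rw [← Category.assoc, D.ι_proj_of_mem h]

lemma ι_proj_of_notMem {K : Set (D.I n)} {a : D.I n} (h : a ∉ K) :
    D.ι n a ≫ D.proj K = 0 := by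
  simp [proj, h]

lemma ι_proj_of_notMem_assoc {K : Set (D.I n)} {a : D.I n} (h : a ∉ K) {Z : C}
    (g : (∐ fun a : K => D.G n a) ⟶ Z) :
    D.ι n a ≫ D.proj K ≫ g = 0 ≫ g := by
  rw [← Category.assoc, D.ι_proj_of_notMem h]

variable {J K : ∀ n, Set (D.I n)}

/-- The subquotient of a complex given by the difference of two closed sets of summands. -/
abbrev subquotient (hJ : D.IsClosed J) (hK : D.IsClosed K) : ChainComplex C ℤ where
  X n := ∐ fun a : (K n \ J n : Set (D.I n)) => D.G n a
  d i j := D.incl (K i \ J i) ≫ X.d i j ≫ D.proj (K j \ J j)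
  shape i j hij := by simp [X.shape _ _ hij]
  d_comp_d' i j k hij hjk := by
    ext ⟨a, ha⟩
    simp only [Category.assoc, ι_incl_assoc, comp_zero]
    rw [D.eq_of_supp a _ (X.d j k ≫ D.proj (K k \ J k))]
    · simp
    · intro b hb
      -- The projection discards only summands in `J`, whose differentials stay in `J` and are
      -- discarded afterwards anyway.
      by_cases hbJ : b ∈ J j
      · rw [ι_proj_of_notMem_assoc _ (fun h => h.2 hbJ), zero_comp,
          D.eq_of_supp b _ 0, comp_zero, comp_zero]
        intro c hc
        rw [ι_proj_of_notMem _ (fun h => h.2 (hJ _ _ hjk _ hbJ hc)), comp_zero]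
      · have hbK : b ∈ K j \ J j := ⟨hK _ _ hij _ ha.1 hb, hbJ⟩
        rw [ι_proj_of_mem_assoc _ hbK, ι_incl_assoc]

/-- The restriction of a cocycle which vanishes on a closed set of summands to a subquotient. -/
abbrev subquotientCocycle (hJ : D.IsClosed J) (hK : D.IsClosed K)
    (hf : ∀ i j, j + 1 = i → ∀ a ∈ J i, D.ι i a ≫ f.f i j = 0) :
    ExtCocycle (D.subquotient hJ hK) Y where
  f i j := D.incl (K i \ J i) ≫ f.f i j
  shape i j hij := by rw [f.shape _ _ hij, comp_zero]
  comp i j k hij hjk := by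
    refine Sigma.hom_ext _ _ fun ⟨a, ha⟩ => ?_
    have := f.comp i j k hij hjk
    simp only [Category.assoc, ι_incl_assoc, comp_zero, Preadditive.comp_add]
    rw [D.eq_of_supp a _ (f.f j k), ← Preadditive.comp_add, this, comp_zero]
    intro b hb
    by_cases hbJ : b ∈ J j
    · rw [ι_proj_of_notMem_assoc _ (fun h => h.2 hbJ), zero_comp, hf _ _ hjk _ hbJ]
    · have hbK : b ∈ K j \ J j := ⟨hK _ _ hij _ ha.1 hb, hbJ⟩
      rw [ι_proj_of_mem_assoc _ hbK, ι_incl_assoc]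

end Subquotient

/-- A cochain which trivializes a cocycle on a closed set of summands. -/
structure PartialTrivialization where
  /-- the set of summands -/
  J (n : ℤ) : Set (D.I n)
  isClosed : D.IsClosed J
  /-- the cochain -/
  h (n : ℤ) : X.X n ⟶ Y.X n
  eq_zero (i j : ℤ) (hij : j + 1 = i) (a : D.I i) (ha : a ∈ J i) :
    D.ι i a ≫ (f.twist h).f i j = 0

namespace PartialTrivialization

variable {D f}

/-- The order relation given by extension of partial trivializations. -/
def Extends (p q : D.PartialTrivialization f) : Prop :=
  ∀ n, p.J n ⊆ q.J n ∧ ∀ a ∈ p.J n, D.ι n a ≫ p.h n = D.ι n a ≫ q.h n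

lemma Extends.trans {p q r : D.PartialTrivialization f} (hpq : p.Extends q) (hqr : q.Extends r) :
    p.Extends r := fun n => ⟨(hpq n).1.trans (hqr n).1,
  fun a ha => ((hpq n).2 a ha).trans ((hqr n).2 a ((hpq n).1 ha))⟩

lemma exists_upperBound (c : Set (D.PartialTrivialization f)) (hc : IsChain Extends c) :
    ∃ q : D.PartialTrivialization f, ∀ p ∈ c, p.Extends q := by
  classical
  let J (n : ℤ) : Set (D.I n) := {a | ∃ p ∈ c, a ∈ p.J n}
  let h (n : ℤ) : X.X n ⟶ Y.X n :=
    D.desc fun a => if ha : a ∈ J n then D.ι n a ≫ ha.choose.h n else 0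
  have hh (p : D.PartialTrivialization f) (hp : p ∈ c) (n : ℤ) (a : D.I n) (ha : a ∈ p.J n) :
      D.ι n a ≫ p.h n = D.ι n a ≫ h n := by
    have ha' : a ∈ J n := ⟨p, hp, ha⟩
    simp only [h, ι_desc, dif_pos ha']
    -- The chosen member of the chain is immaterial, since any two members are comparable and agree
    -- on the smaller set.
    by_cases hpq : p = ha'.choose
    · rw [← hpq]
    · obtain hpq | hpq := hc hp ha'.choose_spec.1 hpq
      · exact (hpq n).2 a ha
      · exact ((hpq n).2 a ha'.choose_spec.2).symm
  refine ⟨{ J := J, h := h, isClosed := ?_, eq_zero := ?_ },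
    fun p hp n => ⟨fun a ha => ⟨p, hp, ha⟩, hh p hp n⟩⟩
  · rintro i j hij a ⟨p, hp, ha⟩ b hb
    exact ⟨p, hp, p.isClosed i j hij a ha hb⟩
  · rintro i j hij a ⟨p, hp, ha⟩
    have := p.eq_zero i j hij a ha
    simp only [ExtCocycle.twist_f, Preadditive.comp_sub] at this ⊢
    rw [← this, reassoc_of% (hh p hp i a ha), D.eq_of_supp a (p.h j) (h j)]
    exact fun b hb => hh p hp j b (p.isClosed i j hij a ha hb)

/-- After twisting by `p.h` the cocycle vanishes on `p.J`, so only its restriction to the new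
summands in `D.reach x` must be bounded. The bounding cochain, extended by zero, is added to `p.h`.
-/
lemma exists_extends [HasCoproducts.{w} C] (p : D.PartialTrivialization f)
    (x : Σ n, D.I n)
    (hf : (D.subquotientCocycle (f.twist p.h) p.isClosed (D.isClosed_reach x)
      p.eq_zero).IsCoboundary) :
    ∃ q : D.PartialTrivialization f, p.Extends q ∧ x.2 ∈ q.J x.1 := by
  obtain ⟨s, hs⟩ := hf
  let s' (n : ℤ) : X.X n ⟶ Y.X n := D.proj (D.reach x n \ p.J n) ≫ s n
  have hs' {n : ℤ} {a : D.I n} (ha : a ∈ p.J n) : D.ι n a ≫ s' n = 0 := by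
    rw [ι_proj_of_notMem_assoc _ (fun h => h.2 ha), zero_comp]
  refine ⟨{ J n := p.J n ∪ D.reach x n
            h n := p.h n + s' n
            isClosed := ?_
            eq_zero := ?_ }, fun n => ⟨Set.subset_union_left, fun a ha => ?_⟩,
            Or.inr (D.mem_reach_self x)⟩
  · rintro i j hij a (ha | ha) b hb
    · exact Or.inl (p.isClosed i j hij a ha hb)
    · exact Or.inr (D.isClosed_reach x i j hij a ha hb)
  · intro i j hij a ha
    have htwist : (f.twist fun n => p.h n + s' n).f i j =
        (f.twist p.h).f i j - (s' i ≫ Y.d i j - X.d i j ≫ s' j) := by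
      simp only [ExtCocycle.twist_f, Preadditive.add_comp, Preadditive.comp_add]
      abel
    rw [htwist, Preadditive.comp_sub, Preadditive.comp_sub]
    by_cases haJ : a ∈ p.J i
    · rw [p.eq_zero i j hij a haJ, reassoc_of% (hs' haJ), zero_comp, D.eq_of_supp a (s' j) 0]
      · simp
      · intro b hb
        rw [hs' (p.isClosed i j hij a haJ hb), comp_zero]
    · have haK : a ∈ D.reach x i \ p.J i := ⟨ha.resolve_left haJ, haJ⟩
      have := Sigma.ι (fun a : (D.reach x i \ p.J i : Set (D.I i)) => D.G i a) ⟨a, haK⟩ ≫=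
        hs i j hij
      rw [← Category.assoc, ι_incl, Preadditive.comp_sub, Category.assoc, Category.assoc,
        ι_incl_assoc] at this
      simp only [s', Category.assoc]
      rw [this, ι_proj_of_mem_assoc _ haK, sub_self]
  · rw [Preadditive.comp_add, hs' ha, add_zero]

end PartialTrivialization

/-- If the cocycles on finite bounded above subquotients are coboundaries, then so are all
cocycles. -/
theorem isCoboundary_of_subquotient [HasCoproducts.{w} C]
    (h : ∀ S : ChainComplex C ℤ, (∃ N : ℤ, ∀ n, N < n → IsZero (S.X n)) →
      (∀ n, ∃ K : Set (D.I n), K.Finite ∧ Nonempty (S.X n ≅ ∐ fun a : K => D.G n a)) →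
      ∀ g : ExtCocycle S Y, g.IsCoboundary) : f.IsCoboundary := by
  obtain ⟨p, hp⟩ := exists_maximal_of_chains_bounded
    (r := PartialTrivialization.Extends (D := D) (f := f))
    (fun c hc => PartialTrivialization.exists_upperBound c hc)
    (fun h₁ h₂ => h₁.trans h₂)
  have hJ (n : ℤ) (a : D.I n) : a ∈ p.J n := by
    obtain ⟨q, hpq, hq⟩ := p.exists_extends ⟨n, a⟩ (by
      apply h
      · refine ⟨n, fun m hm => ?_⟩
        rw [IsZero.iff_id_eq_zero]
        refine Sigma.hom_ext _ _ fun ⟨b, hb⟩ => ?_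
        have := D.le_of_mem_reach hb.1
        dsimp at this
        lia
      · exact fun m => ⟨_, (D.finite_reach ⟨n, a⟩ m).sdiff, ⟨Iso.refl _⟩⟩)
    exact (hp q hpq n).1 hq
  refine ⟨p.h, fun i j hij => D.hom_ext fun a => ?_⟩
  have := p.eq_zero i j hij a (hJ i a)
  rwa [ExtCocycle.twist_f, Preadditive.comp_sub, sub_eq_zero] at this

end FiniteDecomposition

end FiniteSupport

/-! ### The Eilenberg swindle -/

section Swindle

variable {C : Type u} [Category.{v} C] [Abelian C]

/-- The Eilenberg swindle: a retract of `L` is absorbed by a countable coproduct of copies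
of `L`. -/
def swindleIso {X L : C} (r : Retract X L) [HasCoproduct fun _ : ℕ => L] :
    X ⊞ (∐ fun _ : ℕ => L) ≅ ∐ fun _ : ℕ => L where
  -- `L` splits as `X` plus a complement. The extra `X` enters copy `0`, the `X`-part of copy `k`
  -- moves to copy `k + 1`, and the complements stay in place.
  hom := biprod.desc (r.i ≫ Sigma.ι (fun _ : ℕ => L) 0) (Sigma.desc fun k =>
    (r.r ≫ r.i) ≫ Sigma.ι (fun _ : ℕ => L) (k + 1) +
      (𝟙 L - r.r ≫ r.i) ≫ Sigma.ι (fun _ : ℕ => L) k)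
  inv := Sigma.desc fun k => match k with
    | 0 => r.r ≫ biprod.inl + (𝟙 L - r.r ≫ r.i) ≫ Sigma.ι (fun _ : ℕ => L) 0 ≫ biprod.inr
    | k + 1 => ((r.r ≫ r.i) ≫ Sigma.ι (fun _ : ℕ => L) k +
        (𝟙 L - r.r ≫ r.i) ≫ Sigma.ι (fun _ : ℕ => L) (k + 1)) ≫ biprod.inr
  hom_inv_id := by
    refine biprod.hom_ext' _ _ ?_ (Sigma.hom_ext _ _ fun k => ?_)
    · simp [Preadditive.sub_comp]
    · obtain _ | k := k <;> simp [Preadditive.sub_comp]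
  inv_hom_id := by
    refine Sigma.hom_ext _ _ fun k => ?_
    obtain _ | k := k <;> simp [Preadditive.sub_comp]

/-- Associativity of binary biproducts. -/
def biprodAssocIso (X Y Z : C) : X ⊞ (Y ⊞ Z) ≅ (X ⊞ Y) ⊞ Z where
  hom := biprod.lift (biprod.lift biprod.fst (biprod.snd ≫ biprod.fst)) (biprod.snd ≫ biprod.snd)
  inv := biprod.lift (biprod.fst ≫ biprod.fst) (biprod.lift (biprod.fst ≫ biprod.snd) biprod.snd)
  hom_inv_id := by
    refine biprod.hom_ext _ _ (by simp) (biprod.hom_ext _ _ (by simp) (by simp))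
  inv_hom_id := by
    refine biprod.hom_ext _ _ (biprod.hom_ext _ _ (by simp) (by simp)) (by simp)

end Swindle

/-! ### Disks and free complexes -/

section Disk

variable {R : Type u} [Ring R]

/-- The generator of the disk. -/
def diskGen (n : ℤ) : (disk R n).X n :=
  (HomologicalComplex.doubleXIso₀ (𝟙 (ModuleCat.of R R))
    (c := ComplexShape.down ℤ) (sub_add_cancel n 1)).inv (1 : R)

/-- The morphism from the disk given by an element. -/
def diskDesc {n : ℤ} {K : Ch R} (x : K.X n) : disk R n ⟶ K :=
  (HomologicalComplex.evalCompCoyonedaCorepresentableByDoubleId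
    (c := ComplexShape.down ℤ) (sub_add_cancel n 1) (by lia) (ModuleCat.of R R)).homEquiv.symm
      (ModuleCat.ofHom (LinearMap.toSpanSingleton R (K.X n) x))

lemma diskDesc_f_gen {n : ℤ} {K : Ch R} (x : K.X n) : (diskDesc x).f n (diskGen n) = x := by
  have h := (HomologicalComplex.evalCompCoyonedaCorepresentableByDoubleId
    (c := ComplexShape.down ℤ) (sub_add_cancel n 1) (by lia)
      (ModuleCat.of R R)).homEquiv.apply_symm_apply
      (ModuleCat.ofHom (LinearMap.toSpanSingleton R (K.X n) x))
  have := congr_arg (fun φ : ModuleCat.of R R ⟶ K.X n => φ (1 : R)) h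
  simpa using! this

/-- The disk corepresents the underlying elements in degree `n`, with universal element `diskGen n`.
-/
lemma disk_hom_ext {n : ℤ} {K : Ch R} {φ ψ : disk R n ⟶ K}
    (h : φ.f n (diskGen n) = ψ.f n (diskGen n)) : φ = ψ := by
  apply (HomologicalComplex.evalCompCoyonedaCorepresentableByDoubleId
    (c := ComplexShape.down ℤ) (sub_add_cancel n 1) (by lia)
      (ModuleCat.of R R)).homEquiv.injective
  apply ModuleCat.hom_ext
  apply LinearMap.ext_ring
  exact h

instance projective_disk (n : ℤ) : Projective (disk R n) where
  factors {E B} φ e _ := by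
    have : Function.Surjective (e.f n) := (ModuleCat.epi_iff_surjective _).1 inferInstance
    obtain ⟨x, hx⟩ := this (φ.f n (diskGen n))
    refine ⟨diskDesc x, disk_hom_ext ?_⟩
    rw [HomologicalComplex.comp_f, ModuleCat.comp_apply, diskDesc_f_gen, hx]

/-- The image of a disk is contained in every subcomplex which contains the image of its
generator. -/
lemma range_disk_le {n : ℤ} {K : Ch R} (φ : disk R n ⟶ K) (N : ∀ m, Submodule R (K.X m))
    (hN : ∀ i j, (N i).map (K.d i j).hom ≤ N j) (h : φ.f n (diskGen n) ∈ N n) (m : ℤ) :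
    LinearMap.range (φ.f m).hom ≤ N m := by
  have hn : ∀ y : (disk R n).X n, φ.f n y ∈ N n := by
    intro y
    let e := HomologicalComplex.doubleXIso₀ (𝟙 (ModuleCat.of R R))
      (c := ComplexShape.down ℤ) (sub_add_cancel n 1)
    have hy : y = (e.hom y : R) • diskGen n := by
      conv_lhs => rw [← ModuleCat.inv_hom_apply e y]
      have : (e.hom y : R) = (e.hom y : R) • (1 : R) := by simp
      conv_lhs => rw [this]
      exact map_smul e.inv.hom (e.hom y : R) (1 : R)
    rw [hy, map_smul]
    exact (N n).smul_mem _ h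
  rintro _ ⟨y, rfl⟩
  by_cases h₀ : m = n
  · subst h₀
    exact hn y
  · by_cases h₁ : m = n - 1
    · subst h₁
      -- The differential of the disk is an isomorphism, so elements of degree `n - 1` are
      -- boundaries of elements of degree `n`.
      have hd := HomologicalComplex.double_d (𝟙 (ModuleCat.of R R)) (c := ComplexShape.down ℤ)
        (sub_add_cancel n 1) (Ne.symm h₀)
      have hI : IsIso ((HomologicalComplex.double (𝟙 (ModuleCat.of R R))
          (c := ComplexShape.down ℤ) (sub_add_cancel n 1)).d n (n - 1)) := by
        rw [hd]
        infer_instance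
      have : IsIso ((disk R n).d n (n - 1)) := hI
      obtain ⟨z, rfl⟩ := ((ModuleCat.epi_iff_surjective ((disk R n).d n (n - 1))).1
        inferInstance) y
      refine hN n (n - 1) ⟨φ.f n z, hn z, ?_⟩
      exact congr_arg (fun ψ : (disk R n).X n ⟶ K.X (n - 1) => ψ z) (φ.comm n (n - 1))
    · have := HomologicalComplex.isZero_double_X (𝟙 (ModuleCat.of R R))
        (c := ComplexShape.down ℤ) (sub_add_cancel n 1) m h₀ h₁
      have := ModuleCat.subsingleton_of_isZero this
      have hy : y = 0 := Subsingleton.elim (α := (HomologicalComplex.double (𝟙 (ModuleCat.of R R))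
        (c := ComplexShape.down ℤ) (sub_add_cancel n 1)).X m) _ _
      rw [hy, map_zero]
      exact (N m).zero_mem

/-! ### Coproducts of complexes of modules -/

lemma iSup_range_eq_top {I : Type w} {G : I → Ch R} {P : Ch R} {ι : ∀ a, G a ⟶ P}
    [HasCoproductsOfShape I (ModuleCat.{u} R)]
    (hP : IsColimit (Cofan.mk P ι)) (n : ℤ) :
    ⨆ a, LinearMap.range ((ι a).f n).hom = ⊤ := by
  have hc := isColimitOfPreserves (HomologicalComplex.eval (ModuleCat.{u} R) _ n) hP
  have : ModuleCat.ofHom (⨆ a, LinearMap.range ((ι a).f n).hom).mkQ =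
      (0 : P.X n ⟶ ModuleCat.of R _) := by
    refine hc.hom_ext fun ⟨a⟩ => ModuleCat.hom_ext (LinearMap.ext fun x => ?_)
    refine (Submodule.Quotient.mk_eq_zero _).2 ?_
    exact Submodule.mem_iSup_of_mem a ⟨x, rfl⟩
  have := congr_arg ModuleCat.Hom.hom this
  rw [← Submodule.ker_mkQ (⨆ a, LinearMap.range ((ι a).f n).hom)]
  exact LinearMap.ker_eq_top.2 this

/-- An element of a sum of submodules lies in a finite subsum, on which `g` and `g'` agree because
their equalizer is a submodule. -/
lemma exists_finset_support {I : Type w} {G : I → Ch R} {P : Ch R} {ι : ∀ a, G a ⟶ P}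
    [HasCoproductsOfShape I (ModuleCat.{u} R)]
    (hP : IsColimit (Cofan.mk P ι)) {n : ℤ} (x : P.X n) :
    ∃ F : Finset I, ∀ (Z : Ch R) (g g' : P ⟶ Z), (∀ a ∈ F, ι a ≫ g = ι a ≫ g') →
      g.f n x = g'.f n x := by
  have hx : x ∈ ⨆ a, LinearMap.range ((ι a).f n).hom := by
    rw [iSup_range_eq_top hP]
    trivial
  obtain ⟨F, hF⟩ := Submodule.exists_finset_of_mem_iSup _ hx
  refine ⟨F, fun Z g g' h => ?_⟩
  have : ⨆ a ∈ F, LinearMap.range ((ι a).f n).hom ≤ LinearMap.eqLocus (g.f n).hom (g'.f n).hom := by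
    refine iSup₂_le fun a ha => ?_
    rintro _ ⟨y, rfl⟩
    exact congr_arg (fun ψ : G a ⟶ Z => (ψ.f n) y) (h a ha)
  exact this hF

/-- Each of the finitely many generators lies in a finite sum of the given subcomplexes. -/
lemma isFinitelyGeneratedComplex_of_finite {I : Type w} [Finite I] {k : I → ℤ} {P : Ch R}
    {ι : ∀ a, disk R (k a) ⟶ P} (hP : IsColimit (Cofan.mk P ι)) :
    IsFinitelyGeneratedComplex P := by
  classical
  have := Fintype.ofFinite I
  intro T S hS hT
  have (a : I) : ∃ F : Finset T, (ι a).f (k a) (diskGen (k a)) ∈ ⨆ t ∈ F, S t (k a) := by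
    refine Submodule.exists_finset_of_mem_iSup _ ?_
    rw [hT]
    trivial
  choose F hF using this
  refine ⟨Finset.univ.biUnion F, fun n => top_le_iff.1 ?_⟩
  rw [← iSup_range_eq_top hP n]
  refine iSup_le fun a => range_disk_le (ι a)
    (fun m => ⨆ t ∈ Finset.univ.biUnion F, S t m) (fun i j => ?_) ?_ n
  · simp only [Submodule.map_iSup]
    exact iSup₂_mono fun t _ => hS t i j
  · have : ⨆ t ∈ F a, S t (k a) ≤ ⨆ t ∈ Finset.univ.biUnion F, S t (k a) :=
      biSup_mono fun t ht => Finset.mem_biUnion.2 ⟨a, Finset.mem_univ a, ht⟩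
    exact this (hF a)

/-! ### Free complexes -/

lemma isFreeComplex_iff {P : Ch R} : IsFreeComplex P ↔
    ∃ (I : Type u) (k : I → ℤ) (ι : ∀ a, disk R (k a) ⟶ P), Nonempty (IsColimit (Cofan.mk P ι)) := by
  constructor
  · rintro ⟨I, k, ⟨e⟩⟩
    exact ⟨I, k, fun a => Sigma.ι (fun a => disk R (k a)) a ≫ e.inv,
      ⟨IsColimit.ofIsoColimit (coproductIsCoproduct _) (Cofan.ext e.symm fun _ => rfl)⟩⟩
  · rintro ⟨I, k, ι, ⟨h⟩⟩
    exact ⟨I, k, ⟨h.coconePointUniqueUpToIso (coproductIsCoproduct _)⟩⟩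

lemma IsFreeComplex.of_iso {P Q : Ch R} (hP : IsFreeComplex P) (e : P ≅ Q) : IsFreeComplex Q := by
  obtain ⟨I, k, ⟨e'⟩⟩ := hP
  exact ⟨I, k, ⟨e.symm ≪≫ e'⟩⟩

lemma IsFreeComplex.projective {P : Ch R} (hP : IsFreeComplex P) : Projective P := by
  obtain ⟨I, k, ⟨e⟩⟩ := hP
  exact Projective.of_iso e.symm (projective_sigma _ fun a => projective_disk (k a))

lemma IsFreeComplex.biprod {P Q : Ch R} (hP : IsFreeComplex P) (hQ : IsFreeComplex Q) :
    IsFreeComplex (P ⊞ Q) := by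
  rw [isFreeComplex_iff] at hP hQ ⊢
  obtain ⟨I, k, ι, ⟨h⟩⟩ := hP
  obtain ⟨J, l, κ, ⟨h'⟩⟩ := hQ
  refine ⟨I ⊕ J, Sum.elim k l, fun a => match a with
    | Sum.inl a => ι a ≫ biprod.inl
    | Sum.inr b => κ b ≫ biprod.inr, ⟨?_⟩⟩
  refine Cofan.IsColimit.mk _ (fun t => biprod.desc
    (Cofan.IsColimit.desc h fun a => t.inj (Sum.inl a))
    (Cofan.IsColimit.desc h' fun b => t.inj (Sum.inr b))) ?_ ?_
  · rintro t (a | b)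
    · change (ι a ≫ biprod.inl) ≫ _ = _
      rw [Category.assoc, biprod.inl_desc]
      exact Cofan.IsColimit.fac h _ a
    · change (κ b ≫ biprod.inr) ≫ _ = _
      rw [Category.assoc, biprod.inr_desc]
      exact Cofan.IsColimit.fac h' _ b
  · intro t m hm
    refine biprod.hom_ext' _ _ (Cofan.IsColimit.hom_ext h _ _ fun a => ?_)
      (Cofan.IsColimit.hom_ext h' _ _ fun b => ?_)
    · rw [biprod.inl_desc]
      exact ((Category.assoc _ _ _).symm.trans (hm (Sum.inl a))).trans
        (Cofan.IsColimit.fac h (fun a => t.inj (Sum.inl a)) a).symm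
    · rw [biprod.inr_desc]
      exact ((Category.assoc _ _ _).symm.trans (hm (Sum.inr b))).trans
        (Cofan.IsColimit.fac h' (fun b => t.inj (Sum.inr b)) b).symm

lemma IsFreeComplex.sigma {J : Type} {L : J → Ch R} (hL : ∀ j, IsFreeComplex (L j)) :
    IsFreeComplex (∐ L) := by
  simp only [isFreeComplex_iff] at hL ⊢
  choose I k ι h using hL
  exact ⟨Σ j, I j, fun p => k p.1 p.2, fun p => ι p.1 p.2 ≫ Sigma.ι L p.1,
    ⟨Cofan.isColimitTrans _ (coproductIsCoproduct L) ι fun j => (h j).some⟩⟩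

lemma exists_epi_of_isFreeComplex (K : Ch R) :
    ∃ (L : Ch R) (p : L ⟶ K), IsFreeComplex L ∧ Epi p := by
  let p : (∐ fun x : Σ n, K.X n => disk R x.1) ⟶ K := Sigma.desc fun x => diskDesc x.2
  refine ⟨_, p, ⟨_, _, ⟨Iso.refl _⟩⟩, ?_⟩
  have (n : ℤ) : Epi (p.f n) := by
    rw [ModuleCat.epi_iff_surjective]
    intro x
    refine ⟨(Sigma.ι (fun x : Σ n, K.X n => disk R x.1) ⟨n, x⟩).f n (diskGen n), ?_⟩
    rw [← ModuleCat.comp_apply, ← HomologicalComplex.comp_f, Sigma.ι_desc, diskDesc_f_gen]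
  exact HomologicalComplex.epi_of_epi_f _ inferInstance

end Disk

/-! ### Smallness of the generating class -/

section EssentiallySmall

/-- Complexes whose components belong to an essentially small class form an essentially small
class. -/
lemma essentiallySmall_chainComplex {C : Type u} [Category.{v} C] [HasZeroMorphisms C]
    [LocallySmall.{w} C] (P : ObjectProperty C) [ObjectProperty.EssentiallySmall.{w} P] :
    ObjectProperty.EssentiallySmall.{w}
      (fun K => ∀ n, P (K.X n) : ObjectProperty (ChainComplex C ℤ)) := by
  obtain ⟨Q, _, hQ⟩ := ObjectProperty.EssentiallySmall.exists_small_le'.{w} P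
  let T := { x : Σ q : ℤ → Subtype Q, ∀ i j, (q i).1 ⟶ (q j).1 //
    (∀ i j, j + 1 ≠ i → x.2 i j = 0) ∧ ∀ i j k, j + 1 = i → k + 1 = j → x.2 i j ≫ x.2 j k = 0 }
  let o (t : T) : ChainComplex C ℤ :=
    { X i := (t.1.1 i).1
      d i j := t.1.2 i j
      shape i j hij := t.2.1 i j hij
      d_comp_d' i j k hij hjk := t.2.2 i j k hij hjk }
  have : Small.{w} T := inferInstance
  refine ⟨ObjectProperty.ofObj o, inferInstance, fun K hK => ?_⟩
  choose q hq e using fun n => hQ _ (hK n)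
  let t : T := ⟨⟨fun n => ⟨q n, hq n⟩, fun i j => (e i).some.inv ≫ K.d i j ≫ (e j).some.hom⟩,
    fun i j hij => by
      change (e i).some.inv ≫ K.d i j ≫ (e j).some.hom = 0
      rw [K.shape _ _ hij, zero_comp, comp_zero],
    fun i j k _ _ => by simp⟩
  exact ⟨o t, ⟨t⟩, ⟨HomologicalComplex.Hom.isoOfComponents (fun n => (e n).some) fun i j _ => by
    simp [o, t]⟩⟩

variable (R : Type u) [Ring R]

/-- Finitely many of the disk summands already span `X`. Their inclusion is split mono as a partial
coproduct and epi by this choice, hence an isomorphism. -/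
lemma exists_iso_of_isFinitelyGeneratedComplex {X : Ch R} (hX : IsFreeComplex X)
    (hX' : IsFinitelyGeneratedComplex X) :
    ∃ (m : ℕ) (k : Fin m → ℤ), Nonempty (X ≅ ∐ fun a => disk R (k a)) := by
  classical
  obtain ⟨I, k, ι, ⟨h⟩⟩ := isFreeComplex_iff.1 hX
  obtain ⟨J, hJ⟩ := hX' I (fun a n => LinearMap.range ((ι a).f n).hom) (by
    rintro a i j _ ⟨_, ⟨y, rfl⟩, rfl⟩
    exact ⟨(disk R (k a)).d i j y,
      (congr_arg (fun ψ : (disk R (k a)).X i ⟶ X.X j => ψ y) ((ι a).comm i j)).symm⟩)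
    (iSup_range_eq_top h)
  let φ : (∐ fun a : J => disk R (k a)) ⟶ X := Sigma.desc fun a => ι a
  let ψ : X ⟶ ∐ fun a : J => disk R (k a) := Cofan.IsColimit.desc h fun a =>
    if ha : a ∈ J then Sigma.ι (fun a : J => disk R (k a)) ⟨a, ha⟩ else 0
  have hφψ : φ ≫ ψ = 𝟙 _ := by
    refine Sigma.hom_ext _ _ fun ⟨a, ha⟩ => ?_
    rw [Sigma.ι_desc_assoc, Category.comp_id]
    refine (Cofan.IsColimit.fac h _ a).trans ?_
    rw [dif_pos ha]
  have : IsSplitMono φ := ⟨⟨ψ, hφψ⟩⟩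
  have (n : ℤ) : Epi (φ.f n) := by
    rw [ModuleCat.epi_iff_range_eq_top, ← top_le_iff, ← hJ n]
    refine iSup₂_le fun a ha => ?_
    rintro _ ⟨y, rfl⟩
    refine ⟨(Sigma.ι (fun a : J => disk R (k a)) ⟨a, ha⟩).f n y, ?_⟩
    exact congr_arg (fun χ : disk R (k a) ⟶ X => χ.f n y)
      (Sigma.ι_desc (fun a : J => ι a) ⟨a, ha⟩)
  have : Epi φ := HomologicalComplex.epi_of_epi_f _ inferInstance
  have : IsIso φ := isIso_of_mono_of_epi φ
  exact ⟨J.card, _, ⟨(asIso φ).symm ≪≫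
    (Sigma.reindex J.equivFin.symm fun a : J => disk R (k a)).symm⟩⟩

lemma essentiallySmall_boundedAboveFGFree :
    ObjectProperty.EssentiallySmall.{u} (boundedAboveFGFree R) := by
  let Q : ObjectProperty (Ch R) := fun X => IsFreeComplex X ∧ IsFinitelyGeneratedComplex X
  have : ObjectProperty.EssentiallySmall.{u} Q := by
    refine ⟨ObjectProperty.ofObj fun p : Σ m, Fin m → ℤ => ∐ fun a => disk R (p.2 a),
      inferInstance, fun X hX => ?_⟩
    obtain ⟨m, k, e⟩ := exists_iso_of_isFinitelyGeneratedComplex R hX.1 hX.2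
    exact ⟨_, ⟨⟨m, k⟩⟩, e⟩
  have := essentiallySmall_chainComplex.{u} Q
  exact ObjectProperty.EssentiallySmall.of_le
    (Q := (fun K => ∀ n, Q (K.X n) : ObjectProperty (ChCh R))) fun X hX => hX.2

end EssentiallySmall

/-! ### Identification of the left orthogonal -/

section Orthogonal

variable {R : Type u} [Ring R]

/-- Decomposition of a complex of free complexes. -/
lemma nonempty_finiteDecomposition {X : ChCh R} (hX : ∀ n, IsFreeComplex (X.X n)) :
    ∃ D : FiniteDecomposition.{u, u + 1, u} X, ∀ n a, ∃ k, D.G n a = disk R k := by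
  simp only [isFreeComplex_iff] at hX
  choose I k ι h using hX
  choose F hF using fun {i : ℤ} (j : ℤ) (a : I i) =>
    exists_finset_support (h j).some ((ι i a ≫ X.d i j).f (k i a) (diskGen (k i a)))
  refine ⟨{ I := I
            G n a := disk R (k n a)
            ι := ι
            isColimit n := (h n).some
            supp j a := F j a
            finite_supp j a := (F j a).finite_toSet
            eq_of_supp {i j} a Z g g' hg := ?_ }, fun n a => ⟨k n a, rfl⟩⟩
  rw [← Category.assoc, ← Category.assoc]
  refine disk_hom_ext ?_
  have := hF j a Z g g' hg
  simpa using this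

lemma boundedAboveFGFree_le_complexesOfProjectives :
    boundedAboveFGFree R ≤ complexesOfProjectives R :=
  fun _ hX n => (hX.2 n).1.projective

lemma extOneVanishes_of_isFreeComplex {X Y : ChCh R} (hX : ∀ n, IsFreeComplex (X.X n))
    (hY : rightPerp (boundedAboveFGFree R) Y) : ExtOneVanishes X Y := by
  have (n : ℤ) : Projective (X.X n) := (hX n).projective
  obtain ⟨D, hD⟩ := nonempty_finiteDecomposition hX
  refine extOneVanishes_of_isCoboundary fun f => D.isCoboundary_of_subquotient f
    fun S hS hS' g => g.isCoboundary_of_extOneVanishes (hY S ⟨hS, fun n => ?_⟩)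
  obtain ⟨K, hK, ⟨e⟩⟩ := hS' n
  have := hK.to_subtype
  choose k hk using hD n
  have hG : D.G n = fun a => disk R (k a) := funext hk
  rw [hG] at e
  have hc : IsColimit (Cofan.mk (S.X n) fun a : K =>
      Sigma.ι (fun a : K => disk R (k a)) a ≫ e.inv) :=
    IsColimit.ofIsoColimit (coproductIsCoproduct _) (Cofan.ext e.symm fun _ => rfl)
  exact ⟨isFreeComplex_iff.2 ⟨K, fun a => k a, _, ⟨hc⟩⟩,
    isFinitelyGeneratedComplex_of_finite (k := fun a : K => k a) hc⟩

/-- A complex of projective complexes is a retract of a complex of free complexes. -/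
lemma exists_retract_isFreeComplex {X : ChCh R} (hX : complexesOfProjectives R X) :
    ∃ X' : ChCh R, (∀ n, IsFreeComplex (X'.X n)) ∧ Nonempty (Retract X X') := by
  choose L p hL hp using fun n => exists_epi_of_isFreeComplex (X.X n)
  -- All components are retracts of the same free complex, so one `F` absorbs them all in the
  -- swindle, as `contractible F` requires.
  let r (n : ℤ) : Retract (X.X n) (∐ L) :=
    have := hX n
    { i := Projective.factorThru (𝟙 _) (p n) ≫ Sigma.ι L n
      r := Sigma.π L n ≫ p n
      retract := by
        rw [Category.assoc, Sigma.ι_π_eq_id_assoc, Projective.factorThru_comp] }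
  have hF : IsFreeComplex (∐ fun _ : ℕ => ∐ L) :=
    IsFreeComplex.sigma fun _ => IsFreeComplex.sigma hL
  let F : Ch R := ∐ fun _ : ℕ => ∐ L
  refine ⟨X ⊞ contractible F, fun n => ?_, ⟨{ i := biprod.inl, r := biprod.fst }⟩⟩
  refine (hF.biprod hF).of_iso ?_
  exact (HomologicalComplex.biprodXIso X (contractible F) n ≪≫ biprodAssocIso _ F F ≪≫
    biprod.mapIso (swindleIso (r n)) (Iso.refl F)).symm

theorem leftPerp_rightPerp_boundedAboveFGFree :
    leftPerp (rightPerp (boundedAboveFGFree R)) = complexesOfProjectives R := by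
  apply le_antisymm
  · intro X hX n
    refine projective_of_extOneVanishes_contractible (fun A => hX _ fun S hS => ?_) n
    have (n : ℤ) : Projective (S.X n) := boundedAboveFGFree_le_complexesOfProjectives S hS n
    exact extOneVanishes_contractible S A
  · intro X hX Y hY
    obtain ⟨X', hX', ⟨r⟩⟩ := exists_retract_isFreeComplex hX
    exact (extOneVanishes_of_isFreeComplex hX' hY).of_retract r

end Orthogonal

end CotorsionPairs

end

theorem theorem5p3 (R : Type u) [Ring R] :
    ObjectProperty.EssentiallySmall.{u} (CotorsionPairs.boundedAboveFGFree R) ∧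
    CotorsionPairs.IsFunctoriallyCompleteCotorsionPair
      (CotorsionPairs.leftPerp (CotorsionPairs.rightPerp (CotorsionPairs.boundedAboveFGFree R)))
      (CotorsionPairs.rightPerp (CotorsionPairs.boundedAboveFGFree R)) ∧
    CotorsionPairs.leftPerp (CotorsionPairs.rightPerp (CotorsionPairs.boundedAboveFGFree R)) =
      CotorsionPairs.complexesOfProjectives R := by
  have := CotorsionPairs.essentiallySmall_boundedAboveFGFree R
  exact ⟨this, CotorsionPairs.isFunctoriallyCompleteCotorsionPair_of_essentiallySmall.{u} _,
    CotorsionPairs.leftPerp_rightPerp_boundedAboveFGFree⟩
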